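/- Fix $\theta\in\mathbb R$, $\tau\ge 0$ and $q\in(-1,1)$, and write $[n]_q=\sum_{j=0}^{n-1}q^j$. An orthogonality measure of a sequence of real polynomials $(p_n)_{n\ge0}$ is a Borel probability measure on $\mathbb R$ with all moments finite for which $\int p_mp_n\,d\mu=0$ whenever $m\ne n$. For $x\in\mathbb R$ and $0\le s<t$ let $Q_n(y|x,s,t)$ be the polynomials in $y$ given by $Q_0=1$, $Q_1(y|x,s,t)=y-x$ and, for $n\ge1$, $$yQ_n=Q_{n+1}+(\theta[n]_q+xq^n)Q_n+(t-sq^{n-1}+\tau[n-1]_q)[n]_q\,Q_{n-1}.$$ For $x\in\mathbb R$ and $t\ge0$ let $W_n(y;x,t)$ be the polynomials in $y$ given by $W_{-1}=0$, $W_0=1$ and, for $n\ge0$, $$yW_n=W_{n+1}+(\theta[n+1]_q+xq^{n+1})W_n+((1-q)t+\tau)[n]_q[n+1]_q\,W_{n-1}.$$ **Theorem.** For $x\in\mathbb R$ and $0\le s<t$ the sequence $(Q_n(\cdot|x,s,t))_n$ has exactly one orthogonality measure, denoted $P_{s,t}(x,dy)$, and for $x\in\mathbb R$ and $t\ge0$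 the sequence $(W_n(\cdot;x,t))_n$ has exactly one orthogonality measure, denoted $\nu_{x,t}(dy)$. For all $x\in\mathbb R$ and $0\le s<t$ the measure $$\frac{(y-x)^2}{t-s}\,P_{s,t}(x,dy)$$ is a probability measure. For fixed $x\in\mathbb R$ and $t>0$ these measures converge weakly to $\nu_{x,t}(dy)$ as $s\to t^-$. For fixed $x\in\mathbb R$ and $s\ge0$ they converge weakly to $\nu_{x,s}(dy)$ as $t\to s^+$. -/

import Mathlib

open MeasureTheory Filter Topology Polynomial
open scoped BoundedContinuousFunction

namespace QMeixner

/-- The `q`-number `[n]_q = 1 + q + ... + q^(n-1)`. -/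
def qNumber (q : ℝ) (n : ℕ) : ℝ := ∑ j ∈ Finset.range n, q ^ j

/-- The monic polynomials `Q_n(y|x,s,t)` in the variable `y`. The last clause is the three step
recurrence
`y Q_k = Q_{k+1} + (θ [k]_q + x q^k) Q_k + (t - s q^(k-1) + τ [k-1]_q) [k]_q Q_{k-1}`
at `k = n + 1`, solved for `Q_{k+1}`. -/
noncomputable def polyQ (θ τ q x s t : ℝ) : ℕ → ℝ[X]
  | 0 => 1
  | 1 => X - C x
  | n + 2 =>
      (X - C (θ * qNumber q (n + 1) + x * q ^ (n + 1))) * polyQ θ τ q x s t (n + 1)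
        - C ((t - s * q ^ n + τ * qNumber q n) * qNumber q (n + 1)) * polyQ θ τ q x s t n

/-- The monic polynomials `W_n(y;x,t)` in the variable `y`. The last two clauses are the three
step recurrence
`y W_k = W_{k+1} + (θ [k+1]_q + x q^(k+1)) W_k + ((1-q) t + τ) [k]_q [k+1]_q W_{k-1}`,
where `W_{-1} = 0`, at `k = 0` and at `k = n + 1`, solved for `W_{k+1}`. -/
noncomputable def polyW (θ τ q x t : ℝ) : ℕ → ℝ[X]
  | 0 => 1
  | 1 => X - C (θ * qNumber q 1 + x * q ^ 1)
  | n + 2 =>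
      (X - C (θ * qNumber q (n + 2) + x * q ^ (n + 2))) * polyW θ τ q x t (n + 1)
        - C (((1 - q) * t + τ) * qNumber q (n + 1) * qNumber q (n + 2)) * polyW θ τ q x t n

/-- `μ` is an orthogonality measure of the sequence of polynomials `p`: a (Borel) probability
measure on the real line with finite moments of all orders, for which `p m` and `p n` are
orthogonal whenever `m ≠ n`. -/
structure IsOrthogonalityMeasure (p : ℕ → ℝ[X]) (μ : Measure ℝ) : Prop where
  isProbabilityMeasure : IsProbabilityMeasure μ
  integrable_pow : ∀ n : ℕ, Integrable (fun y : ℝ => y ^ n) μ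
  orthogonal : ∀ m n : ℕ, m ≠ n → ∫ y, (p m).eval y * (p n).eval y ∂μ = 0

/-- The orthogonality measure of a sequence of polynomials (meaningful when it exists and is
unique). -/
noncomputable def orthogonalityMeasure (p : ℕ → ℝ[X]) : Measure ℝ :=
  Classical.epsilon (IsOrthogonalityMeasure p)

/-- The transition probability `P_{s,t}(x,dy)` of the `q`-Meixner process. -/
noncomputable def transP (θ τ q s t x : ℝ) : Measure ℝ :=
  orthogonalityMeasure (polyQ θ τ q x s t)

/-- The measure `ν_{x,t}(dy)`. -/
noncomputable def nu (θ τ q x t : ℝ) : Measure ℝ :=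
  orthogonalityMeasure (polyW θ τ q x t)

/-- The measure `(y-x)²/(t-s) · P_{s,t}(x,dy)`. -/
noncomputable def scaledP (θ τ q s t x : ℝ) : Measure ℝ :=
  (transP θ τ q s t x).withDensity (fun y => ENNReal.ofReal ((y - x) ^ 2 / (t - s)))

/-- Weak convergence along the filter `l` of the measures `M i` to the measure `μ`: integrals of
all bounded continuous functions converge (used only for probability measures). -/
def WeaklyConverges {ι : Type*} (M : ι → Measure ℝ) (l : Filter ι) (μ : Measure ℝ) : Prop :=
  ∀ f : ℝ →ᵇ ℝ, Tendsto (fun i => ∫ y, f y ∂(M i)) l (𝓝 (∫ y, f y ∂μ))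

end QMeixner

/-!
The polynomials `Q_n` and `W_n` are the monic polynomials `jacobiPoly` of Jacobi matrices with bounded
coefficients and nonnegative off-diagonal part. Such a matrix is a bounded self-adjoint operator `J`
on `ℓ²`, and the spectral measure of `J` at the first basis vector is an orthogonality measure
carried by a bounded interval (`exists_isOrthogonalityMeasure`). Orthogonality determines the
integrals of all polynomials; a measure with the moments of a measure of bounded support has the same
bounded support, so by Weierstrass approximation there is only one orthogonality measure
(`existsUnique_isOrthogonalityMeasure`).

In the recurrence of `Q_n` the first off-diagonal coefficient is `∫ (y - x)² dP_{s,t} = t - s`, so the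
rescaled measure has mass one. As `t - s → 0` the first index decouples from the others, and the
Jacobi matrix of `W_n` is exactly that of `Q_n` at `s = t` with the first index removed
(`polyW_eq_jacobiPoly`). The measure `(y - x)² / (t - s) · P_{s,t}` is the spectral measure at the
second basis vector, hence should converge to `ν`. Concretely, for the polynomials `V_n` obtained from
`Q_n` by removing the first index, `∫ V_n (y - x)² / (t - s) dP_{s,t}` equals
`∫ (y - x) U_{n-1} dP_{s,t}` for `n ≥ 1`, where `U_n` are the polynomials with two indices removed
(`integral_withDensity_associated`). This is `O(√(t - s))`, while `V_n → W_n` uniformly on bounded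
sets. So the integral of each `W_n` converges to its integral against `ν`; the `W_n` span all
polynomials and all supports lie in one interval, which gives weak convergence
(`weaklyConverges_withDensity`).
-/

namespace QMeixner

/-! ### Orthogonality measures from Jacobi operators -/

/-- The spectral measure of a bounded self-adjoint operator `T` at a unit vector `v`. The functional
`f ↦ ⟪v, f(T) v⟫` on `C(spectrum ℝ T, ℝ)` given by the continuous functional calculus is positive,
so the Riesz–Markov–Kakutani theorem represents it by a measure on the spectrum, which is then
pushed forward to `ℝ`. -/
theorem exists_spectralMeasure {H : Type*} [NormedAddCommGroup H] [InnerProductSpace ℂ H]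
    [CompleteSpace H] (T : H →L[ℂ] H) (hT : IsSelfAdjoint T) (v : H) (hv : ‖v‖ = 1) :
    ∃ μ : Measure ℝ, IsProbabilityMeasure μ ∧ (∀ᵐ y ∂μ, |y| ≤ ‖T‖) ∧
      ∀ p : ℝ[X], ∫ y, p.eval y ∂μ = (inner ℂ v (aeval T p v)).re := by
  have : Nontrivial H := ⟨v, 0, by rintro rfl; simp at hv⟩
  let K := spectrum ℝ T
  have : CompactSpace K := isCompact_iff_compactSpace.mp (spectrum.isCompact (𝕜 := ℝ) T)
  let Φ : C(K, ℝ) →⋆ₐ[ℝ] (H →L[ℂ] H) := cfcHom hT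
  let Λ₀ : CompactlySupportedContinuousMap K ℝ →ₗ[ℝ] ℝ :=
    { toFun := fun f => (inner ℂ v (Φ f.toContinuousMap v)).re
      map_add' := fun f g => by
        have : (f + g).toContinuousMap = f.toContinuousMap + g.toContinuousMap := rfl
        rw [this, map_add]
        simp
      map_smul' := fun c f => by
        have : (c • f).toContinuousMap = c • f.toContinuousMap := rfl
        rw [this, map_smul]
        simp [inner_smul_right_eq_smul] }
  have hpos : ∀ f, 0 ≤ f → 0 ≤ Λ₀ f := fun f hf => by
    -- `f = g²` with `g = √f`, hence `⟪v, f(T) v⟫ = ‖g(T) v‖²`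
    let g : C(K, ℝ) := ⟨fun y => √(f y), by fun_prop⟩
    have hg : f.toContinuousMap = g * g := by
      ext y
      exact (Real.mul_self_sqrt (hf y)).symm
    have hsa : ContinuousLinearMap.adjoint (Φ g) = Φ g := by
      rw [← ContinuousLinearMap.star_eq_adjoint, ← map_star]
      rfl
    change 0 ≤ (inner ℂ v (Φ f.toContinuousMap v)).re
    rw [hg, map_mul, mul_apply_eq_comp, ← ContinuousLinearMap.adjoint_inner_left, hsa]
    exact inner_self_nonneg (𝕜 := ℂ)
  let Λ := PositiveLinearMap.mk₀ Λ₀ hpos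
  let ρ : Measure K := RealRMK.rieszMeasure Λ
  have hρ (f : C(K, ℝ)) : ∫ y, f y ∂ρ = (inner ℂ v (Φ f v)).re :=
    RealRMK.integral_rieszMeasure Λ (CompactlySupportedContinuousMap.continuousMapEquiv f)
  have hfin : IsFiniteMeasure ρ :=
    ⟨isCompact_univ.measure_lt_top⟩
  have hprob : IsProbabilityMeasure ρ := by
    have h1 := hρ 1
    refine ⟨?_⟩
    simp only [ContinuousMap.one_apply, integral_const, smul_eq_mul, mul_one, map_one,
      one_apply_eq_self, inner_self_eq_norm_sq_to_K, hv] at h1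
    norm_num [Measure.real] at h1
    rwa [ENNReal.toReal_eq_one_iff] at h1
  refine ⟨ρ.map Subtype.val, Measure.isProbabilityMeasure_map measurable_subtype_coe.aemeasurable,
    ?_, fun p => ?_⟩
  · rw [ae_map_iff measurable_subtype_coe.aemeasurable
      (measurableSet_le (by fun_prop) (by fun_prop))]
    exact Eventually.of_forall fun y => spectrum.norm_le_norm_of_mem y.2
  · rw [integral_map measurable_subtype_coe.aemeasurable p.continuous.aestronglyMeasurable]
    have hp : Φ (toContinuousMapOnAlgHom K p) = aeval T p := by
      have h : (Φ : C(K, ℝ) →ₐ[ℝ] (H →L[ℂ] H)).comp (toContinuousMapOnAlgHom K) = aeval T := by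
        apply Polynomial.algHom_ext
        have hX : toContinuousMapOnAlgHom K (X : ℝ[X]) =
            (ContinuousMap.id ℝ).restrict (spectrum ℝ T) := by
          ext y
          simp
        rw [aeval_X]
        exact (congrArg Φ hX).trans (cfcHom_id hT)
      exact DFunLike.congr_fun h p
    rw [← hp, ← hρ]
    rfl

/-- The monic polynomials of the Jacobi matrix with diagonal `b 0, b 1, …` and squared off-diagonal
entries `ω 0, ω 1, …`: `y P_{n+1} = P_{n+2} + b_{n+1} P_{n+1} + ω_n P_n`. Here `ω n` is the entry
linking the indices `n` and `n + 1`; it may vanish. -/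
noncomputable def jacobiPoly (b ω : ℕ → ℝ) : ℕ → ℝ[X]
  | 0 => 1
  | 1 => X - C (b 0)
  | n + 2 => (X - C (b (n + 1))) * jacobiPoly b ω (n + 1) - C (ω n) * jacobiPoly b ω n

/-- If `J` acts on an orthonormal sequence `e` as a Jacobi matrix, then `P_n(J) e_0` is a multiple of
`e_n`, so the spectral measure of `J` at `e_0` makes the `P_n` orthogonal. -/
theorem exists_isOrthogonalityMeasure_of_selfAdjoint {H : Type*} [NormedAddCommGroup H]
    [InnerProductSpace ℂ H] [CompleteSpace H] {J : H →L[ℂ] H} (hJ : IsSelfAdjoint J) {e : ℕ → H}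
    (he : Orthonormal ℂ e) {b ω : ℕ → ℝ} (hω : ∀ n, 0 ≤ ω n)
    (hJ0 : J (e 0) = b 0 • e 0 + √(ω 0) • e 1)
    (hJs : ∀ n, J (e (n + 1)) = √(ω n) • e n + b (n + 1) • e (n + 1) + √(ω (n + 1)) • e (n + 2)) :
    ∃ μ : Measure ℝ, IsOrthogonalityMeasure (jacobiPoly b ω) μ ∧ ∀ᵐ y ∂μ, |y| ≤ ‖J‖ := by
  obtain ⟨μ, hμ, hsupp, hint⟩ := exists_spectralMeasure J hJ (e 0) (he.norm_eq_one 0)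
  have hP (n : ℕ) : aeval J (jacobiPoly b ω n) (e 0) = (∏ k ∈ Finset.range n, √(ω k)) • e n := by
    induction n using Nat.twoStepInduction with
    | zero => simp [jacobiPoly]
    | one =>
      have : aeval J (jacobiPoly b ω 1) = J - b 0 • 1 := by
        simp [jacobiPoly, Algebra.algebraMap_eq_smul_one]
      rw [this, _root_.sub_apply, hJ0]
      simp
    | more n h₁ h₂ =>
      have : aeval J (jacobiPoly b ω (n + 2)) =
          (J - b (n + 1) • 1) * aeval J (jacobiPoly b ω (n + 1))
            - ω n • aeval J (jacobiPoly b ω n) := by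
        simp [jacobiPoly, Algebra.algebraMap_eq_smul_one]
      rw [this, _root_.sub_apply, mul_apply_eq_comp, _root_.smul_apply, h₁, h₂,
        ContinuousLinearMap.map_smul_of_tower, _root_.sub_apply, hJs, _root_.smul_apply,
        one_apply_eq_self,
        Finset.prod_range_succ, Finset.prod_range_succ, Finset.prod_range_succ]
      linear_combination (norm := module)
        ((∏ k ∈ Finset.range n, √(ω k)) * (Real.mul_self_sqrt (hω n))) • e n
  have hsaP (p : ℝ[X]) : ContinuousLinearMap.adjoint (aeval J p) = aeval J p := by
    rw [← ContinuousLinearMap.star_eq_adjoint]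
    induction p using Polynomial.induction_on' with
    | add p q hp hq => simp [hp, hq]
    | monomial n c => simp [aeval_monomial, hJ.star_eq, Algebra.algebraMap_eq_smul_one]
  refine ⟨μ, ⟨hμ, fun n => ?_, fun m n hmn => ?_⟩, hsupp⟩
  · refine Integrable.of_bound (by fun_prop) (‖J‖ ^ n) (hsupp.mono fun y hy => ?_)
    rw [norm_pow, Real.norm_eq_abs]
    gcongr
  · simp only [← eval_mul]
    rw [hint, map_mul, mul_apply_eq_comp, ← ContinuousLinearMap.adjoint_inner_left, hsaP, hP, hP,
      inner_smul_left_eq_smul, inner_smul_right_eq_smul, he.inner_eq_zero hmn]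
    simp

/-- The complex Hilbert space `ℓ²(ℕ)`. -/
abbrev ell2 : Type := lp (fun _ : ℕ => ℂ) 2

/-- The bounded operator `f ↦ c · (f ∘ σ)` on `ℓ²`. The identity `σ` gives diagonal operators and the
successor gives weighted backward shifts. -/
theorem exists_weightedComposition (σ : ℕ → ℕ) (hσ : σ.Injective) (c : ℕ → ℝ) (C : ℝ)
    (hc : ∀ n, |c n| ≤ C) :
    ∃ T : ell2 →L[ℂ] ell2, ‖T‖ ≤ C ∧ ∀ f n, T f n = c n * f (σ n) := by
  have hC : 0 ≤ C := (abs_nonneg _).trans (hc 0)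
  have hsum (f : ell2) : Summable fun n => ‖f n‖ ^ 2 := by
    simpa using (lp.memℓp f).summable (by norm_num)
  have hle (f : ell2) (n : ℕ) : ‖(c n : ℂ) * f (σ n)‖ ^ 2 ≤ C ^ 2 * ‖f (σ n)‖ ^ 2 := by
    rw [norm_mul, mul_pow, Complex.norm_real, Real.norm_eq_abs]
    gcongr
    exact hc n
  have hmaj (f : ell2) : Summable fun n => C ^ 2 * ‖f (σ n)‖ ^ 2 :=
    ((hsum f).comp_injective hσ).mul_left _
  have hsum' (f : ell2) : Summable fun n => ‖(c n : ℂ) * f (σ n)‖ ^ 2 :=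
    (hmaj f).of_nonneg_of_le (fun _ => by positivity) (hle f)
  let T₀ : ell2 →ₗ[ℂ] ell2 :=
    { toFun := fun f => ⟨fun n => c n * f (σ n), memℓp_gen (by simpa using hsum' f)⟩
      map_add' := fun f g => by
        ext n
        exact mul_add _ _ _
      map_smul' := fun a f => by
        ext n
        exact mul_left_comm _ _ _ }
  have hT₀ (f : ell2) : ‖T₀ f‖ ≤ C * ‖f‖ := by
    refine lp.norm_le_of_tsum_le (by norm_num) (by positivity) ?_
    have hf : ‖f‖ ^ 2 = ∑' n, ‖f n‖ ^ 2 := by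
      simpa using lp.norm_rpow_eq_tsum (p := 2) (by norm_num) f
    norm_num
    rw [mul_pow, hf, ← tsum_mul_left]
    calc ∑' n, ‖(c n : ℂ) * f (σ n)‖ ^ 2 ≤ ∑' n, C ^ 2 * ‖f (σ n)‖ ^ 2 :=
          (hsum' f).tsum_le_tsum (hle f) (hmaj f)
      _ ≤ ∑' n, C ^ 2 * ‖f n‖ ^ 2 :=
          tsum_comp_le_tsum_of_inj ((hsum f).mul_left _) (fun _ => by positivity) hσ
  exact ⟨T₀.mkContinuous C hT₀, T₀.mkContinuous_norm_le hC hT₀, fun f n => rfl⟩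

/-- The Jacobi matrix with diagonal `b` and off-diagonal `a`, as the self-adjoint operator
`D + (S† + S)` with `D` diagonal and `S` a weighted backward shift. -/
theorem exists_jacobiOperator (b a : ℕ → ℝ) (A B : ℝ) (hb : ∀ n, |b n| ≤ B)
    (ha : ∀ n, |a n| ≤ A) :
    ∃ (J : ell2 →L[ℂ] ell2) (e : ℕ → ell2), IsSelfAdjoint J ∧ Orthonormal ℂ e ∧ ‖J‖ ≤ B + 2 * A ∧
      J (e 0) = b 0 • e 0 + a 0 • e 1 ∧
      ∀ n, J (e (n + 1)) = a n • e n + b (n + 1) • e (n + 1) + a (n + 1) • e (n + 2) := by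
  obtain ⟨D, hD, hDapp⟩ := exists_weightedComposition id Function.injective_id b B hb
  obtain ⟨S, hS, hSapp⟩ := exists_weightedComposition (· + 1) (add_left_injective 1) a A ha
  let e (n : ℕ) : ell2 := lp.single 2 n 1
  have e_apply (m n : ℕ) : e m n = if n = m then 1 else 0 := by
    simp [e, Pi.single_apply]
  have inner_e (n : ℕ) (f : ell2) : inner ℂ (e n) f = f n := by
    simp [e, lp.inner_single_left]
  have smul_coe (r : ℝ) (f : ell2) (n : ℕ) : (r • f) n = r * f n := rfl
  have add_coe (f g : ell2) (n : ℕ) : (f + g) n = f n + g n := rfl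
  have hDsa : IsSelfAdjoint D := by
    rw [ContinuousLinearMap.isSelfAdjoint_iff_isSymmetric]
    intro f g
    simp [lp.inner_eq_tsum, hDapp, mul_left_comm, mul_assoc]
  have hadj (n : ℕ) : ContinuousLinearMap.adjoint S (e n) = a n • e (n + 1) := by
    ext m
    rw [← inner_e, ContinuousLinearMap.adjoint_inner_right, ← inner_conj_symm, inner_e, hSapp,
      smul_coe]
    by_cases h : n + 1 = m
    · subst h; simp [e_apply]
    · simp [e_apply, h, Ne.symm h]
  have hSsa : IsSelfAdjoint (ContinuousLinearMap.adjoint S + S) := IsSelfAdjoint.star_add_self S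
  refine ⟨D + (ContinuousLinearMap.adjoint S + S), e, hDsa.add hSsa, ?_, ?_, ?_, fun n => ?_⟩
  · refine orthonormal_iff_ite.2 fun m n => ?_
    rw [inner_e, e_apply]
  · calc ‖D + (ContinuousLinearMap.adjoint S + S)‖
        ≤ ‖D‖ + (‖ContinuousLinearMap.adjoint S‖ + ‖S‖) :=
          (norm_add_le _ _).trans (by gcongr; exact norm_add_le _ _)
      _ ≤ B + 2 * A := by rw [LinearIsometryEquiv.norm_map]; linarith
  · rw [_root_.add_apply, _root_.add_apply, hadj]
    ext m
    simp only [add_coe, smul_coe, hDapp, hSapp, e_apply]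
    by_cases h : m = 0 <;> simp [h]
  · rw [_root_.add_apply, _root_.add_apply, hadj]
    ext m
    simp only [add_coe, smul_coe, hDapp, hSapp, e_apply]
    by_cases h : m = n
    · have h' : n ≠ n + 1 + 1 := by omega
      simp [h, h']
    · by_cases h' : m = n + 1 <;> simp [h, h']

/-- Favard's theorem for bounded coefficients, with a bound for the support of the measure. -/
theorem exists_isOrthogonalityMeasure {b ω : ℕ → ℝ} {A B : ℝ} (hb : ∀ n, |b n| ≤ B)
    (hω : ∀ n, 0 ≤ ω n) (hA : ∀ n, √(ω n) ≤ A) :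
    ∃ μ : Measure ℝ, IsOrthogonalityMeasure (jacobiPoly b ω) μ ∧
      ∀ᵐ y ∂μ, |y| ≤ B + 2 * A := by
  obtain ⟨J, e, hJ, he, hnorm, hJ0, hJs⟩ := exists_jacobiOperator b (fun n => √(ω n)) A B hb
    (fun n => by rw [abs_of_nonneg (Real.sqrt_nonneg _)]; exact hA n)
  obtain ⟨μ, hμ, hsupp⟩ := exists_isOrthogonalityMeasure_of_selfAdjoint hJ he hω hJ0 hJs
  exact ⟨μ, hμ, hsupp.mono fun y hy => hy.trans hnorm⟩

/-! ### Measures carried by a bounded interval -/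

theorem integrable_eval_of_ae_abs_le {μ : Measure ℝ} [IsFiniteMeasure μ] {R : ℝ}
    (hR : ∀ᵐ y ∂μ, |y| ≤ R) (p : ℝ[X]) : Integrable (fun y => p.eval y) μ := by
  obtain ⟨C, hC⟩ := (isCompact_Icc (a := -R) (b := R)).exists_bound_of_continuousOn
    p.continuous.continuousOn
  exact .of_bound p.continuous.aestronglyMeasurable C (hR.mono fun y hy => hC y (abs_le.1 hy))

/-- For probability measures carried by one bounded interval, convergence of the integrals of
polynomials implies weak convergence, by the Weierstrass approximation theorem. -/
theorem weaklyConverges_of_tendsto_integral_eval {ι : Type*} {l : Filter ι} {M : ι → Measure ℝ}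
    {ν : Measure ℝ} [IsProbabilityMeasure ν] {R : ℝ} (hM : ∀ᶠ i in l, IsProbabilityMeasure (M i))
    (hMR : ∀ᶠ i in l, ∀ᵐ y ∂M i, |y| ≤ R) (hνR : ∀ᵐ y ∂ν, |y| ≤ R)
    (h : ∀ p : ℝ[X], Tendsto (fun i => ∫ y, p.eval y ∂M i) l (𝓝 (∫ y, p.eval y ∂ν))) :
    WeaklyConverges M l ν := by
  intro f
  rw [Metric.tendsto_nhds]
  intro ε hε
  obtain ⟨p, hp⟩ := exists_polynomial_near_of_continuousOn (-R) R f f.continuous.continuousOn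
    (ε / 4) (by positivity)
  have key (ρ : Measure ℝ) (hρ : IsProbabilityMeasure ρ) (hρR : ∀ᵐ y ∂ρ, |y| ≤ R) :
      |(∫ y, p.eval y ∂ρ) - ∫ y, f y ∂ρ| ≤ ε / 4 := by
    rw [← integral_sub (integrable_eval_of_ae_abs_le hρR p) (f.integrable ρ)]
    have := norm_integral_le_of_norm_le_const (f := fun y => p.eval y - f y) (μ := ρ)
      (hρR.mono fun y hy => (hp y (abs_le.1 hy)).le)
    simpa using this
  have hν := abs_le.1 (key ν inferInstance hνR)
  filter_upwards [hM, hMR, Metric.tendsto_nhds.1 (h p) (ε / 4) (by positivity)] with i h1 h2 h3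
  have hi := abs_le.1 (key (M i) h1 h2)
  rw [Real.dist_eq, abs_lt] at *
  constructor <;> linarith [h3.1, h3.2, hi.1, hi.2, hν.1, hν.2]

theorem measure_eq_of_integral_eval_eq {μ ν : Measure ℝ} [IsProbabilityMeasure μ]
    [IsProbabilityMeasure ν] {R : ℝ} (hμ : ∀ᵐ y ∂μ, |y| ≤ R) (hν : ∀ᵐ y ∂ν, |y| ≤ R)
    (h : ∀ p : ℝ[X], ∫ y, p.eval y ∂μ = ∫ y, p.eval y ∂ν) : μ = ν := by
  refine ext_of_forall_integral_eq_of_IsFiniteMeasure fun f => ?_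
  -- weak convergence of the constant sequence `μ` to `ν`
  refine tendsto_nhds_unique (tendsto_const_nhds (f := (atTop : Filter ℕ)))
    (weaklyConverges_of_tendsto_integral_eval (M := fun _ => μ) (.of_forall fun _ => inferInstance)
      (.of_forall fun _ => hμ) hν (fun p => ?_) f)
  rw [h p]
  exact tendsto_const_nhds

/-- A probability measure with the moments of a measure carried by `[-R, R]` is itself carried by
`[-R, R]`: for `r > R`, the Markov inequality for `y ^ (2 * n)` bounds the mass of `{r ≤ |y|}` by
`(R / r) ^ (2 * n)`. This makes uniqueness hold among all measures with finite moments. -/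
theorem ae_abs_le_of_integral_pow_eq {μ ν : Measure ℝ} [IsProbabilityMeasure μ]
    [IsProbabilityMeasure ν] {R : ℝ} (hμ : ∀ᵐ y ∂μ, |y| ≤ R)
    (hint : ∀ n : ℕ, Integrable (fun y : ℝ => y ^ n) ν)
    (h : ∀ n : ℕ, ∫ y, y ^ n ∂ν = ∫ y, y ^ n ∂μ) : ∀ᵐ y ∂ν, |y| ≤ R := by
  have hR : 0 ≤ R := by
    obtain ⟨y, hy⟩ := hμ.exists
    exact (abs_nonneg y).trans hy
  have key (r : ℝ) (hr : R < r) : ∀ᵐ y ∂ν, |y| < r := by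
    have hr0 : 0 < r := hR.trans_lt hr
    have hle (n : ℕ) : ν.real {y | r ≤ |y|} ≤ ((R / r) ^ 2) ^ n := by
      have h1 : r ^ (2 * n) * ν.real {y | r ^ (2 * n) ≤ y ^ (2 * n)} ≤ ∫ y, y ^ (2 * n) ∂ν :=
        mul_meas_ge_le_integral_of_nonneg
          (.of_forall fun y => (even_two_mul n).pow_nonneg y) (hint _) _
      have h2 : ∫ y, y ^ (2 * n) ∂μ ≤ R ^ (2 * n) := by
        have hbound : ∀ᵐ y ∂μ, ‖y ^ (2 * n)‖ ≤ R ^ (2 * n) := hμ.mono fun y hy => by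
          rw [norm_pow, Real.norm_eq_abs]
          gcongr
        have := norm_integral_le_of_norm_le_const hbound
        rw [probReal_univ, mul_one] at this
        exact (le_abs_self _).trans this
      have h3 : ν.real {y | r ≤ |y|} ≤ ν.real {y | r ^ (2 * n) ≤ y ^ (2 * n)} := by
        refine measureReal_mono fun y (hy : r ≤ |y|) => ?_
        rw [Set.mem_ofPred_eq, ← (even_two_mul n).pow_abs y]
        gcongr
      rw [← pow_mul, div_pow, le_div_iff₀ (by positivity), mul_comm]
      calc r ^ (2 * n) * ν.real {y | r ≤ |y|}
          ≤ r ^ (2 * n) * ν.real {y | r ^ (2 * n) ≤ y ^ (2 * n)} := by gcongr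
        _ ≤ R ^ (2 * n) := h1.trans ((h _).trans_le h2)
    have hq : (R / r) ^ 2 < 1 := by
      have : R / r < 1 := (div_lt_one hr0).2 hr
      have : 0 ≤ R / r := by positivity
      nlinarith
    have hzero : ν.real {y | r ≤ |y|} ≤ 0 :=
      ge_of_tendsto' (tendsto_pow_atTop_nhds_zero_of_lt_one (by positivity) hq) hle
    have := le_antisymm hzero measureReal_nonneg
    rw [measureReal_eq_zero_iff] at this
    rw [ae_iff]
    simpa using this
  have hall : ∀ᵐ y ∂ν, ∀ n : ℕ, |y| < R + 1 / ((n : ℝ) + 1) :=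
    ae_all_iff.2 fun n => key _ (by linarith [Nat.one_div_pos_of_nat (α := ℝ) (n := n)])
  refine hall.mono fun y hy => ?_
  refine ge_of_tendsto' (f := fun n : ℕ => R + 1 / ((n : ℝ) + 1)) (x := atTop) ?_ fun n => (hy n).le
  simpa using tendsto_one_div_add_atTop_nhds_zero_nat.const_add R

/-! ### Existence and uniqueness of the orthogonality measure -/

theorem span_jacobiPoly (b ω : ℕ → ℝ) :
    Submodule.span ℝ (Set.range (jacobiPoly b ω)) = ⊤ := by
  set M := Submodule.span ℝ (Set.range (jacobiPoly b ω))
  have hP (n : ℕ) : jacobiPoly b ω n ∈ M := Submodule.subset_span ⟨n, rfl⟩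
  have hX (p : ℝ[X]) (hp : p ∈ M) : X * p ∈ M := by
    induction hp using Submodule.span_induction with
    | mem p hp =>
      obtain ⟨n, rfl⟩ := hp
      cases n with
      | zero =>
        convert M.add_mem (hP 1) (M.smul_mem (b 0) (hP 0)) using 1
        simp [jacobiPoly, smul_eq_C_mul]
      | succ n =>
        convert M.add_mem (M.add_mem (hP (n + 2)) (M.smul_mem (b (n + 1)) (hP (n + 1))))
          (M.smul_mem (ω n) (hP n)) using 1
        simp only [jacobiPoly, smul_eq_C_mul]
        ring
    | zero => simp
    | add p r _ _ hp hr => rw [mul_add]; exact M.add_mem hp hr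
    | smul c p _ hp => rw [mul_smul_comm]; exact M.smul_mem c hp
  have hXn (n : ℕ) : (X ^ n : ℝ[X]) ∈ M := by
    induction n with
    | zero => simpa [jacobiPoly] using hP 0
    | succ n ih => rw [pow_succ']; exact hX _ ih
  refine Submodule.eq_top_iff'.2 fun p => ?_
  induction p using Polynomial.induction_on' with
  | add p r hp hr => exact M.add_mem hp hr
  | monomial n c => rw [← C_mul_X_pow_eq_monomial, ← smul_eq_C_mul]; exact M.smul_mem c (hXn n)

namespace IsOrthogonalityMeasure

variable {p : ℕ → ℝ[X]} {b ω : ℕ → ℝ} {μ ν : Measure ℝ}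

theorem integrable_eval (h : IsOrthogonalityMeasure p μ) (r : ℝ[X]) :
    Integrable (fun y => r.eval y) μ := by
  induction r using Polynomial.induction_on' with
  | add r s hr hs => exact (hr.add hs).congr (.of_forall fun y => by simp)
  | monomial n c =>
    exact ((h.integrable_pow n).const_mul c).congr (.of_forall fun y => by simp)

theorem integral_jacobiPoly (h : IsOrthogonalityMeasure (jacobiPoly b ω) μ) (n : ℕ) :
    ∫ y, (jacobiPoly b ω n).eval y ∂μ = if n = 0 then 1 else 0 := by
  have := h.isProbabilityMeasure
  split_ifs with hn
  · simp [hn, jacobiPoly]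
  · simpa [jacobiPoly] using h.orthogonal n 0 hn

theorem integral_eval_eq (hμ : IsOrthogonalityMeasure (jacobiPoly b ω) μ)
    (hν : IsOrthogonalityMeasure (jacobiPoly b ω) ν) (r : ℝ[X]) :
    ∫ y, r.eval y ∂μ = ∫ y, r.eval y ∂ν := by
  have hr : r ∈ Submodule.span ℝ (Set.range (jacobiPoly b ω)) := by simp [span_jacobiPoly]
  induction hr using Submodule.span_induction with
  | mem r hr =>
    obtain ⟨n, rfl⟩ := hr
    rw [hμ.integral_jacobiPoly, hν.integral_jacobiPoly]
  | zero => simp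
  | add r s _ _ hr hs =>
    simp only [eval_add]
    rw [integral_add (hμ.integrable_eval r) (hμ.integrable_eval s),
      integral_add (hν.integrable_eval r) (hν.integrable_eval s), hr, hs]
  | smul c r _ hr => simp only [eval_smul, smul_eq_mul, integral_const_mul, hr]

/-- Every orthogonality measure, not only the one built from the Jacobi operator, satisfies the
support bound, because orthogonality determines all moments. -/
theorem ae_abs_le {A B : ℝ} (hν : IsOrthogonalityMeasure (jacobiPoly b ω) ν)
    (hb : ∀ n, |b n| ≤ B) (hω : ∀ n, 0 ≤ ω n) (hA : ∀ n, √(ω n) ≤ A) :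
    ∀ᵐ y ∂ν, |y| ≤ B + 2 * A := by
  obtain ⟨μ, hμ, hμR⟩ := exists_isOrthogonalityMeasure hb hω hA
  have := hμ.isProbabilityMeasure
  have := hν.isProbabilityMeasure
  exact ae_abs_le_of_integral_pow_eq hμR hν.integrable_pow fun n => by
    simpa using hν.integral_eval_eq hμ (X ^ n)

end IsOrthogonalityMeasure

theorem existsUnique_isOrthogonalityMeasure {b ω : ℕ → ℝ} {A B : ℝ} (hb : ∀ n, |b n| ≤ B)
    (hω : ∀ n, 0 ≤ ω n) (hA : ∀ n, √(ω n) ≤ A) :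
    ∃! μ : Measure ℝ, IsOrthogonalityMeasure (jacobiPoly b ω) μ := by
  obtain ⟨μ, hμ, hμR⟩ := exists_isOrthogonalityMeasure hb hω hA
  refine ⟨μ, hμ, fun ν hν => ?_⟩
  have := hμ.isProbabilityMeasure
  have := hν.isProbabilityMeasure
  exact measure_eq_of_integral_eval_eq (hν.ae_abs_le hb hω hA) hμR (hν.integral_eval_eq hμ)

/-! ### Squares of the first polynomial as densities -/

/-- Expansion of the Jacobi determinant along its first row, in terms of the polynomials of the Jacobi
matrices with the first one and the first two indices removed. -/
theorem jacobiPoly_eq_associated (b ω : ℕ → ℝ) (n : ℕ) :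
    jacobiPoly b ω (n + 2) =
      (X - C (b 0)) * jacobiPoly (fun k => b (k + 1)) (fun k => ω (k + 1)) (n + 1)
        - C (ω 0) * jacobiPoly (fun k => b (k + 2)) (fun k => ω (k + 2)) n := by
  induction n using Nat.twoStepInduction with
  | zero => simp only [jacobiPoly]; ring
  | one => simp only [jacobiPoly]; ring
  | more n h₁ h₂ =>
    rw [jacobiPoly, h₁, h₂]
    simp only [jacobiPoly]
    ring

namespace IsOrthogonalityMeasure

variable {b ω : ℕ → ℝ} {μ : Measure ℝ}

theorem integral_sub_sq (h : IsOrthogonalityMeasure (jacobiPoly b ω) μ) :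
    ∫ y, (y - b 0) ^ 2 ∂μ = ω 0 := by
  have := h.isProbabilityMeasure
  have hpoly : (X - C (b 0)) ^ 2 =
      jacobiPoly b ω 2 + C (b 1 - b 0) * jacobiPoly b ω 1 + C (ω 0) := by
    simp only [jacobiPoly, C_sub]
    ring
  have heval (y : ℝ) : (y - b 0) ^ 2 = (jacobiPoly b ω 2).eval y
      + (b 1 - b 0) * (jacobiPoly b ω 1).eval y + ω 0 := by
    simpa using congrArg (eval y) hpoly
  simp only [heval]
  have hi : Integrable (fun y => (jacobiPoly b ω 2).eval y
      + (b 1 - b 0) * (jacobiPoly b ω 1).eval y) μ :=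
    (h.integrable_eval _).add ((h.integrable_eval _).const_mul _)
  rw [integral_add hi (integrable_const _),
    integral_add (h.integrable_eval _) ((h.integrable_eval _).const_mul _),
    integral_const_mul, h.integral_jacobiPoly, h.integral_jacobiPoly]
  simp

theorem integral_abs_sub_le (h : IsOrthogonalityMeasure (jacobiPoly b ω) μ) (h0 : 0 < ω 0) :
    ∫ y, |y - b 0| ∂μ ≤ √(ω 0) := by
  have := h.isProbabilityMeasure
  have hs : 0 < √(ω 0) := Real.sqrt_pos.2 h0
  have hi1 : Integrable (fun y => |y - b 0|) μ := by
    exact (h.integrable_eval (X - C (b 0))).abs.congr (.of_forall fun y => by simp)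
  have hi2 : Integrable (fun y => (y - b 0) ^ 2) μ := by
    exact (h.integrable_eval ((X - C (b 0)) ^ 2)).congr (.of_forall fun y => by simp)
  have hle : ∫ y, 2 * √(ω 0) * |y - b 0| ∂μ ≤ ∫ y, ((y - b 0) ^ 2 + ω 0) ∂μ := by
    refine integral_mono (hi1.const_mul _) (hi2.add (integrable_const _)) fun y => ?_
    -- `2 √ω₀ |y - b₀| ≤ (y - b₀)² + ω₀`
    have h1 := sq_nonneg (|y - b 0| - √(ω 0))
    have h2 := sq_abs (y - b 0)
    have h3 := Real.sq_sqrt h0.le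
    simp only
    nlinarith
  rw [integral_const_mul, integral_add hi2 (integrable_const _), h.integral_sub_sq] at hle
  have h3 := Real.mul_self_sqrt h0.le
  simp at hle
  nlinarith

theorem isProbabilityMeasure_withDensity (h : IsOrthogonalityMeasure (jacobiPoly b ω) μ)
    (h0 : 0 < ω 0) :
    IsProbabilityMeasure (μ.withDensity fun y => ENNReal.ofReal ((y - b 0) ^ 2 / ω 0)) := by
  refine ⟨?_⟩
  have hi2 : Integrable (fun y => (y - b 0) ^ 2) μ := by
    exact (h.integrable_eval ((X - C (b 0)) ^ 2)).congr (.of_forall fun y => by simp)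
  rw [withDensity_apply _ MeasurableSet.univ, Measure.restrict_univ,
    ← ofReal_integral_eq_lintegral_ofReal (hi2.div_const _)
      (.of_forall fun y => div_nonneg (sq_nonneg _) h0.le),
    integral_div, h.integral_sub_sq, div_self h0.ne', ENNReal.ofReal_one]

/-- The defect of orthogonality of the associated polynomials for the density `(y - b 0)² / ω 0`: in
`jacobiPoly_eq_associated` multiplied by `P_1 / ω 0`, the term `P_1 P_{n+2} / ω 0` integrates to
zero and the factor `ω 0` of the last term cancels. What remains is of order `√(ω 0)`. -/
theorem integral_withDensity_associated (h : IsOrthogonalityMeasure (jacobiPoly b ω) μ)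
    (h0 : 0 < ω 0) (n : ℕ) :
    ∫ y, (jacobiPoly (fun k => b (k + 1)) (fun k => ω (k + 1)) (n + 1)).eval y
        ∂(μ.withDensity fun y => ENNReal.ofReal ((y - b 0) ^ 2 / ω 0))
      = ∫ y, (y - b 0) * (jacobiPoly (fun k => b (k + 2)) (fun k => ω (k + 2)) n).eval y ∂μ := by
  rw [integral_withDensity_eq_integral_toReal_smul (by fun_prop)
    (.of_forall fun _ => ENNReal.ofReal_lt_top)]
  have heval (y : ℝ) : (ENNReal.ofReal ((y - b 0) ^ 2 / ω 0)).toReal •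
        (jacobiPoly (fun k => b (k + 1)) (fun k => ω (k + 1)) (n + 1)).eval y =
      (jacobiPoly b ω 1).eval y * (jacobiPoly b ω (n + 2)).eval y / ω 0
        + (y - b 0) * (jacobiPoly (fun k => b (k + 2)) (fun k => ω (k + 2)) n).eval y := by
    rw [ENNReal.toReal_ofReal (div_nonneg (sq_nonneg _) h0.le), jacobiPoly_eq_associated b ω n]
    simp only [show jacobiPoly b ω 1 = X - C (b 0) from rfl, eval_sub, eval_mul, eval_X, eval_C,
      smul_eq_mul]
    field_simp
    ring
  simp only [heval]
  rw [integral_add, integral_div, h.orthogonal 1 (n + 2) (by omega), zero_div, zero_add]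
  · exact ((h.integrable_eval (jacobiPoly b ω 1 * jacobiPoly b ω (n + 2))).div_const (ω 0)).congr
      (.of_forall fun y => by simp)
  · exact (h.integrable_eval
      ((X - C (b 0)) * jacobiPoly (fun k => b (k + 2)) (fun k => ω (k + 2)) n)).congr
      (.of_forall fun y => by simp)

end IsOrthogonalityMeasure

/-- The polynomials depend continuously on the off-diagonal coefficients, in the sup norm on a compact
set. -/
theorem tendsto_toContinuousMapOn_jacobiPoly {ι : Type*} {l : Filter ι} (K : Set ℝ) [CompactSpace K]
    (b : ℕ → ℝ)
    {ω : ι → ℕ → ℝ} {ω' : ℕ → ℝ} (hω : ∀ n, Tendsto (fun i => ω i n) l (𝓝 (ω' n))) (n : ℕ) :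
    Tendsto (fun i => toContinuousMapOnAlgHom K (jacobiPoly b (ω i) n)) l
      (𝓝 (toContinuousMapOnAlgHom K (jacobiPoly b ω' n))) := by
  induction n using Nat.twoStepInduction with
  | zero => exact tendsto_const_nhds
  | one => exact tendsto_const_nhds
  | more n h₁ h₂ =>
    simp only [jacobiPoly, map_sub _ (_ * _), map_mul, ← smul_eq_C_mul, map_smul]
    exact (h₂.const_mul _).sub ((hω n).smul h₁)

theorem abs_integral_mul_eval_le {μ : Measure ℝ} {R : ℝ} (hR : ∀ᵐ y ∂μ, |y| ≤ R) {g : ℝ → ℝ}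
    (hg : Integrable g μ) (p : ℝ[X]) :
    |∫ y, g y * p.eval y ∂μ| ≤
      (∫ y, |g y| ∂μ) * ‖toContinuousMapOnAlgHom (Set.Icc (-R) R) p‖ := by
  rw [← integral_mul_const]
  refine norm_integral_le_of_norm_le (f := fun y => g y * p.eval y) (hg.abs.mul_const _)
    (hR.mono fun y hy => ?_)
  rw [norm_mul, Real.norm_eq_abs]
  gcongr
  exact (toContinuousMapOnAlgHom (Set.Icc (-R) R) p).norm_coe_le_norm ⟨y, abs_le.1 hy⟩

/-- When the first off-diagonal coefficient tends to `0`, the measures `(y - b 0)² / ω 0 · μ` converge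
to the orthogonality measure of the Jacobi matrix with the first index removed. -/
theorem weaklyConverges_withDensity {ι : Type*} {l : Filter ι} {b : ℕ → ℝ} {ω : ι → ℕ → ℝ}
    {ω' : ℕ → ℝ} {μ : ι → Measure ℝ} {ν : Measure ℝ} {R : ℝ}
    (hμ : ∀ᶠ i in l, IsOrthogonalityMeasure (jacobiPoly b (ω i)) (μ i))
    (hμR : ∀ᶠ i in l, ∀ᵐ y ∂μ i, |y| ≤ R)
    (hν : IsOrthogonalityMeasure (jacobiPoly (fun n => b (n + 1)) ω') ν)
    (hνR : ∀ᵐ y ∂ν, |y| ≤ R) (hpos : ∀ᶠ i in l, 0 < ω i 0)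
    (h0 : Tendsto (fun i => ω i 0) l (𝓝 0))
    (hω : ∀ n, Tendsto (fun i => ω i (n + 1)) l (𝓝 (ω' n))) :
    WeaklyConverges
      (fun i => (μ i).withDensity fun y => ENNReal.ofReal ((y - b 0) ^ 2 / ω i 0)) l ν := by
  set M := fun i => (μ i).withDensity fun y => ENNReal.ofReal ((y - b 0) ^ 2 / ω i 0)
  have := hν.isProbabilityMeasure
  have hMprob : ∀ᶠ i in l, IsProbabilityMeasure (M i) := by
    filter_upwards [hμ, hpos] with i h1 h2 using h1.isProbabilityMeasure_withDensity h2
  have hMR : ∀ᶠ i in l, ∀ᵐ y ∂M i, |y| ≤ R := by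
    filter_upwards [hμR] with i hi
    exact (withDensity_absolutelyContinuous _ _).ae_le hi
  refine weaklyConverges_of_tendsto_integral_eval hMprob hMR hνR fun p => ?_
  have hp : p ∈ Submodule.span ℝ (Set.range (jacobiPoly (fun n => b (n + 1)) ω')) := by
    simp [span_jacobiPoly]
  induction hp using Submodule.span_induction with
  | mem p hp =>
    obtain ⟨n, rfl⟩ := hp
    rw [hν.integral_jacobiPoly]
    cases n with
    | zero =>
      refine Tendsto.congr' ?_ tendsto_const_nhds
      filter_upwards [hMprob] with i hi
      simp [jacobiPoly]
    | succ n =>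
      rw [if_neg n.succ_ne_zero]
      -- `V i` approximates the limit polynomial `W` uniformly, and its integral against `M i` is
      -- `∫ (y - b 0) U i ∂μ i`, which is at most `√(ω i 0) * ‖U i‖`.
      set φ := toContinuousMapOnAlgHom (Set.Icc (-R) R)
      set W := jacobiPoly (fun k => b (k + 1)) ω' (n + 1)
      let V i := jacobiPoly (fun k => b (k + 1)) (fun k => ω i (k + 1)) (n + 1)
      let U i := jacobiPoly (fun k => b (k + 2)) (fun k => ω i (k + 2)) n
      have hV : Tendsto (fun i => ‖φ (W - V i)‖) l (𝓝 0) := by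
        have h1 := (tendsto_const_nhds (x := φ W)).sub
          (tendsto_toContinuousMapOn_jacobiPoly (Set.Icc (-R) R) (fun k => b (k + 1)) hω (n + 1))
        rw [sub_self] at h1
        have h2 := h1.norm
        rw [norm_zero] at h2
        simpa only [map_sub] using h2
      have hU : Tendsto (fun i => √(ω i 0) * ‖φ (U i)‖) l (𝓝 0) := by
        have h1 := (tendsto_toContinuousMapOn_jacobiPoly (Set.Icc (-R) R) (fun k => b (k + 2))
          (ω := fun i k => ω i (k + 2)) (fun k => hω (k + 1)) n).norm
        have h2 := h0.sqrt.mul h1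
        rwa [Real.sqrt_zero, zero_mul] at h2
      refine squeeze_zero_norm' ?_ (by simpa using hV.add hU)
      filter_upwards [hμ, hμR, hMprob, hMR, hpos] with i h1 h2 h3 h4 h5
      have hsplit : ∫ y, W.eval y ∂M i = (∫ y, (W - V i).eval y ∂M i) + ∫ y, (V i).eval y ∂M i := by
        rw [← integral_add (integrable_eval_of_ae_abs_le h4 _)
          (integrable_eval_of_ae_abs_le h4 _)]
        simp
      rw [hsplit, h1.integral_withDensity_associated h5 n]
      refine (norm_add_le _ _).trans (add_le_add ?_ ?_)
      · have := abs_integral_mul_eval_le h4 (integrable_const 1) (W - V i)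
        simp only [one_mul, abs_one, integral_const, probReal_univ, smul_eq_mul, map_sub] at this
        exact this
      · refine (abs_integral_mul_eval_le h2 (g := fun y => y - b 0) ?_ _).trans ?_
        · exact (h1.integrable_eval (X - C (b 0))).congr (.of_forall fun y => by simp)
        · gcongr
          exact h1.integral_abs_sub_le h5
  | zero => simpa using tendsto_const_nhds
  | add p r _ _ hp hr =>
    simp only [eval_add]
    rw [integral_add (hν.integrable_eval p) (hν.integrable_eval r)]
    refine (hp.add hr).congr' ?_
    filter_upwards [hMprob, hMR] with i h1 h2
    exact (integral_add (integrable_eval_of_ae_abs_le h2 p)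
      (integrable_eval_of_ae_abs_le h2 r)).symm
  | smul c p _ hp =>
    simp only [eval_smul, smul_eq_mul, integral_const_mul]
    exact hp.const_mul c

/-! ### The coefficients of the `q`-Meixner recurrences -/

theorem qNumber_nonneg {q : ℝ} (hq : q ∈ Set.Ioo (-1 : ℝ) 1) (n : ℕ) : 0 ≤ qNumber q n := by
  have h1 : q ^ n ≤ 1 := (le_abs_self _).trans <| by
    rw [abs_pow]
    exact pow_le_one₀ (abs_nonneg q) (abs_lt.2 hq).le
  have h2 : (1 - q) * qNumber q n = 1 - q ^ n := mul_neg_geom_sum q n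
  have h3 : 0 < 1 - q := sub_pos.2 hq.2
  exact nonneg_of_mul_nonneg_right (h2 ▸ sub_nonneg.2 h1) h3

theorem qNumber_le {q : ℝ} (hq : q ∈ Set.Ioo (-1 : ℝ) 1) (n : ℕ) :
    qNumber q n ≤ (1 - |q|)⁻¹ := by
  calc qNumber q n ≤ ∑ j ∈ Finset.range n, |q| ^ j :=
        Finset.sum_le_sum fun j _ => (le_abs_self _).trans (abs_pow q j).le
    _ ≤ ∑' j : ℕ, |q| ^ j :=
        (summable_geometric_of_lt_one (abs_nonneg q) (abs_lt.2 hq)).sum_le_tsum _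
          fun _ _ => by positivity
    _ = (1 - |q|)⁻¹ := tsum_geometric_of_lt_one (abs_nonneg q) (abs_lt.2 hq)

/-- The diagonal coefficients `θ [n]_q + x q^n` of the recurrence of `polyQ`. -/
noncomputable def diagCoeff (θ q x : ℝ) (n : ℕ) : ℝ := θ * qNumber q n + x * q ^ n

/-- The coefficients `(t - s q^n + τ [n]_q) [n+1]_q` of `Q_n` in the recurrence for `y Q_{n+1}`. -/
noncomputable def offDiagCoeff (τ q s t : ℝ) (n : ℕ) : ℝ :=
  (t - s * q ^ n + τ * qNumber q n) * qNumber q (n + 1)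

theorem diagCoeff_zero (θ q x : ℝ) : diagCoeff θ q x 0 = x := by simp [diagCoeff, qNumber]

theorem offDiagCoeff_zero (τ q s t : ℝ) : offDiagCoeff τ q s t 0 = t - s := by
  simp [offDiagCoeff, qNumber]

theorem polyQ_eq_jacobiPoly (θ τ q x s t : ℝ) :
    polyQ θ τ q x s t = jacobiPoly (diagCoeff θ q x) (offDiagCoeff τ q s t) := by
  funext n
  induction n using Nat.twoStepInduction with
  | zero => rfl
  | one => simp [polyQ, jacobiPoly, diagCoeff_zero]
  | more n h₁ h₂ => rw [polyQ, jacobiPoly, h₁, h₂, diagCoeff, offDiagCoeff]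

/-- The polynomials `W_n(·; x, t)` belong to the Jacobi matrix of `Q_n(· | x, t, t)` with the first
index removed, since `t - t q^(n+1) + τ [n+1]_q = ((1-q) t + τ) [n+1]_q`. -/
theorem polyW_eq_jacobiPoly (θ τ q x t : ℝ) :
    polyW θ τ q x t = jacobiPoly (fun n => diagCoeff θ q x (n + 1))
      (fun n => offDiagCoeff τ q t t (n + 1)) := by
  funext n
  induction n using Nat.twoStepInduction with
  | zero => rfl
  | one => rfl
  | more n h₁ h₂ =>
    have hω : offDiagCoeff τ q t t (n + 1) =
        ((1 - q) * t + τ) * qNumber q (n + 1) * qNumber q (n + 2) := by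
      have h : (1 - q) * qNumber q (n + 1) = 1 - q ^ (n + 1) := mul_neg_geom_sum q (n + 1)
      rw [offDiagCoeff]
      linear_combination -t * qNumber q (n + 2) * h
    rw [polyW, jacobiPoly, h₁, h₂, hω, diagCoeff]

theorem abs_diagCoeff_le {q : ℝ} (hq : q ∈ Set.Ioo (-1 : ℝ) 1) (θ x : ℝ) (n : ℕ) :
    |diagCoeff θ q x n| ≤ |θ| * (1 - |q|)⁻¹ + |x| := by
  refine (abs_add_le _ _).trans (add_le_add ?_ ?_)
  · rw [abs_mul, abs_of_nonneg (qNumber_nonneg hq n)]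
    gcongr
    exact qNumber_le hq n
  · rw [abs_mul, abs_pow]
    exact mul_le_of_le_one_right (abs_nonneg x) (pow_le_one₀ (abs_nonneg q) (abs_lt.2 hq).le)

theorem abs_mul_pow_le {q s : ℝ} (hq : q ∈ Set.Ioo (-1 : ℝ) 1) (hs : 0 ≤ s) (n : ℕ) :
    |s * q ^ n| ≤ s := by
  rw [abs_mul, abs_pow, abs_of_nonneg hs]
  exact mul_le_of_le_one_right hs (pow_le_one₀ (abs_nonneg q) (abs_lt.2 hq).le)

theorem offDiagCoeff_nonneg {τ q s t : ℝ} (hq : q ∈ Set.Ioo (-1 : ℝ) 1) (hτ : 0 ≤ τ) (hs : 0 ≤ s)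
    (hst : s ≤ t) (n : ℕ) : 0 ≤ offDiagCoeff τ q s t n := by
  have h1 := abs_le.1 (abs_mul_pow_le hq hs n)
  have h2 := mul_nonneg hτ (qNumber_nonneg hq n)
  exact mul_nonneg (by linarith) (qNumber_nonneg hq _)

theorem sqrt_offDiagCoeff_le {τ q s t T : ℝ} (hq : q ∈ Set.Ioo (-1 : ℝ) 1) (hτ : 0 ≤ τ) (hs : 0 ≤ s)
    (hst : s ≤ t) (hT : t ≤ T) (n : ℕ) :
    √(offDiagCoeff τ q s t n) ≤ √((2 * T + τ * (1 - |q|)⁻¹) * (1 - |q|)⁻¹) := by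
  have h1 := abs_le.1 (abs_mul_pow_le hq hs n)
  have h2 := mul_le_mul_of_nonneg_left (qNumber_le hq n) hτ
  have h3 := qNumber_nonneg hq (n + 1)
  have h4 := mul_nonneg hτ (qNumber_nonneg hq n)
  refine Real.sqrt_le_sqrt (mul_le_mul (by linarith) (qNumber_le hq _) h3 (by linarith))

/-! ### Transition probabilities and their limits -/

theorem orthogonalityMeasure_spec {p : ℕ → ℝ[X]}
    (h : ∃! μ : Measure ℝ, IsOrthogonalityMeasure p μ) :
    IsOrthogonalityMeasure p (orthogonalityMeasure p) :=
  Classical.epsilon_spec h.exists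

theorem existsUnique_polyQ {τ q s t : ℝ} (hτ : 0 ≤ τ) (hq : q ∈ Set.Ioo (-1 : ℝ) 1) (hs : 0 ≤ s)
    (θ x : ℝ) (hst : s < t) :
    ∃! μ : Measure ℝ, IsOrthogonalityMeasure (polyQ θ τ q x s t) μ := by
  rw [polyQ_eq_jacobiPoly]
  exact existsUnique_isOrthogonalityMeasure (abs_diagCoeff_le hq θ x)
    (offDiagCoeff_nonneg hq hτ hs hst.le) (sqrt_offDiagCoeff_le hq hτ hs hst.le le_rfl)

theorem existsUnique_polyW {τ q s : ℝ} (hτ : 0 ≤ τ) (hq : q ∈ Set.Ioo (-1 : ℝ) 1) (hs : 0 ≤ s)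
    (θ x : ℝ) :
    ∃! μ : Measure ℝ, IsOrthogonalityMeasure (polyW θ τ q x s) μ := by
  rw [polyW_eq_jacobiPoly]
  exact existsUnique_isOrthogonalityMeasure (fun n => abs_diagCoeff_le hq θ x (n + 1))
    (fun n => offDiagCoeff_nonneg hq hτ hs le_rfl (n + 1))
    (fun n => sqrt_offDiagCoeff_le hq hτ hs le_rfl le_rfl (n + 1))

theorem isOrthogonalityMeasure_transP {τ q s t : ℝ} (hτ : 0 ≤ τ)
    (hq : q ∈ Set.Ioo (-1 : ℝ) 1) (hs : 0 ≤ s) (θ x : ℝ) (hst : s < t) :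
    IsOrthogonalityMeasure (jacobiPoly (diagCoeff θ q x) (offDiagCoeff τ q s t))
      (transP θ τ q s t x) := by
  rw [← polyQ_eq_jacobiPoly]
  exact orthogonalityMeasure_spec (existsUnique_polyQ hτ hq hs θ x hst)

theorem isOrthogonalityMeasure_nu {τ q s : ℝ} (hτ : 0 ≤ τ) (hq : q ∈ Set.Ioo (-1 : ℝ) 1) (hs : 0 ≤ s)
    (θ x : ℝ) :
    IsOrthogonalityMeasure (jacobiPoly (fun n => diagCoeff θ q x (n + 1))
      (fun n => offDiagCoeff τ q s s (n + 1))) (nu θ τ q x s) := by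
  rw [← polyW_eq_jacobiPoly]
  exact orthogonalityMeasure_spec (existsUnique_polyW hτ hq hs θ x)

theorem scaledP_eq_withDensity (θ τ q s t x : ℝ) :
    scaledP θ τ q s t x = (transP θ τ q s t x).withDensity fun y =>
      ENNReal.ofReal ((y - diagCoeff θ q x 0) ^ 2 / offDiagCoeff τ q s t 0) := by
  rw [scaledP, diagCoeff_zero, offDiagCoeff_zero]

theorem isProbabilityMeasure_scaledP {τ q s t : ℝ} (hτ : 0 ≤ τ)
    (hq : q ∈ Set.Ioo (-1 : ℝ) 1) (hs : 0 ≤ s) (θ x : ℝ) (hst : s < t) :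
    IsProbabilityMeasure (scaledP θ τ q s t x) := by
  rw [scaledP_eq_withDensity]
  exact (isOrthogonalityMeasure_transP hτ hq hs θ x hst).isProbabilityMeasure_withDensity
    (by rw [offDiagCoeff_zero]; linarith)

/-- Convergence when `s` and `t` vary together towards a common value `u`; it contains both one-sided
limits. -/
theorem weaklyConverges_scaledP {ι : Type*} {l : Filter ι} {τ q : ℝ} (hτ : 0 ≤ τ)
    (hq : q ∈ Set.Ioo (-1 : ℝ) 1) {s t : ι → ℝ} {u : ℝ} (θ x : ℝ) (hu : 0 ≤ u)
    (hs : ∀ᶠ i in l, 0 ≤ s i) (hst : ∀ᶠ i in l, s i < t i)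
    (hsu : Tendsto s l (𝓝 u)) (htu : Tendsto t l (𝓝 u)) :
    WeaklyConverges (fun i => scaledP θ τ q (s i) (t i) x) l (nu θ τ q x u) := by
  have ht : ∀ᶠ i in l, t i ≤ u + 1 :=
    (htu.eventually (gt_mem_nhds (by linarith))).mono fun _ => le_of_lt
  have hω (n : ℕ) : Tendsto (fun i => offDiagCoeff τ q (s i) (t i) n) l
      (𝓝 (offDiagCoeff τ q u u n)) :=
    ((htu.sub (hsu.mul_const _)).add_const _).mul_const _
  have hν := isOrthogonalityMeasure_nu hτ hq hu θ x
  simp only [scaledP_eq_withDensity]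
  -- the coefficients are bounded uniformly as soon as `t i ≤ u + 1`
  refine weaklyConverges_withDensity (b := diagCoeff θ q x) (R := (|θ| * (1 - |q|)⁻¹ + |x|)
      + 2 * √((2 * (u + 1) + τ * (1 - |q|)⁻¹) * (1 - |q|)⁻¹)) ?_ ?_ hν
    (hν.ae_abs_le (fun n => abs_diagCoeff_le hq θ x (n + 1))
      (fun n => offDiagCoeff_nonneg hq hτ hu le_rfl (n + 1))
      (fun n => sqrt_offDiagCoeff_le hq hτ hu le_rfl (by linarith) (n + 1))) ?_ ?_
    fun n => hω (n + 1)
  · filter_upwards [hs, hst] with i h1 h2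
    exact isOrthogonalityMeasure_transP hτ hq h1 θ x h2
  · filter_upwards [hs, hst, ht] with i h1 h2 h3
    exact (isOrthogonalityMeasure_transP hτ hq h1 θ x h2).ae_abs_le (abs_diagCoeff_le hq θ x)
      (offDiagCoeff_nonneg hq hτ h1 h2.le) (sqrt_offDiagCoeff_le hq hτ h1 h2.le h3)
  · filter_upwards [hst] with i hi
    rw [offDiagCoeff_zero]
    linarith
  · simpa [offDiagCoeff_zero] using hω 0

end QMeixner

theorem theorem1p2 (θ τ q x : ℝ) (hτ : 0 ≤ τ) (hq : q ∈ Set.Ioo (-1 : ℝ) 1) :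
    -- the measures `P_{s,t}(x,dy)` and `ν_{x,t}(dy)` are well defined
    (∀ s t : ℝ, 0 ≤ s → s < t →
      ∃! μ : Measure ℝ, QMeixner.IsOrthogonalityMeasure (QMeixner.polyQ θ τ q x s t) μ) ∧
    (∀ t : ℝ, 0 ≤ t →
      ∃! μ : Measure ℝ, QMeixner.IsOrthogonalityMeasure (QMeixner.polyW θ τ q x t) μ) ∧
    -- the rescaled transition probabilities are probability measures
    (∀ s t : ℝ, 0 ≤ s → s < t → IsProbabilityMeasure (QMeixner.scaledP θ τ q s t x)) ∧
    -- limit as `s → t⁻`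
    (∀ t : ℝ, 0 < t →
      QMeixner.WeaklyConverges (fun s => QMeixner.scaledP θ τ q s t x) (𝓝[<] t)
        (QMeixner.nu θ τ q x t)) ∧
    -- limit as `t → s⁺`
    (∀ s : ℝ, 0 ≤ s →
      QMeixner.WeaklyConverges (fun t => QMeixner.scaledP θ τ q s t x) (𝓝[>] s)
        (QMeixner.nu θ τ q x s)) := by
  refine ⟨fun s t hs hst => QMeixner.existsUnique_polyQ hτ hq hs θ x hst,
    fun t ht => QMeixner.existsUnique_polyW hτ hq ht θ x,
    fun s t hs hst => QMeixner.isProbabilityMeasure_scaledP hτ hq hs θ x hst,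
    fun t ht => ?_, fun s hs => ?_⟩
  · exact QMeixner.weaklyConverges_scaledP hτ hq θ x ht.le
      ((eventually_ge_nhds ht).filter_mono nhdsWithin_le_nhds) self_mem_nhdsWithin
      (tendsto_id.mono_left nhdsWithin_le_nhds) tendsto_const_nhds
  · exact QMeixner.weaklyConverges_scaledP hτ hq θ x hs (.of_forall fun _ => hs)
      self_mem_nhdsWithin tendsto_const_nhds (tendsto_id.mono_left nhdsWithin_le_nhds)
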